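/- Setting. Consider a non-relativistic complex bosonic field $\varphi(\tau,\vec x)$ (imaginary time $\tau\in\mathbb R$, $\vec x\in\mathbb R^d$, $s$ components) with $U(1)$-invariant flowing action $\Gamma_k[\varphi]=\sum_n\Gamma_k^{\{n\}}[\varphi]$, $\Gamma_k^{\{n\}}=\frac1{n!^2}\int V_n\,\varphi^{*n}\varphi^n$. For $n\ge 2$ the one-particle irreducible $n$-body vertex function $V_n$ is a locally finite complex measure on the $n$ outgoing legs (contracted with $\varphi^*$) and $n$ incoming legs (contracted with $\varphi$), symmetric in each kind of legs. Let $G_k=(\Gamma_k^{\{1\}}+R_k)^{-1}$ be the regularized propagator and $\tilde\partial_kG_k=-G_k(\partial_kR_k)G_k$ its regulator scale derivative. The flow equations are the field expansion of $\partial_k\Gamma_k=\frac12\mathrm{Tr}\,\tilde\partial_k\ln(\Gamma_k^{(2)}+R_k)$ (one-loop rings of vertices $V_b$, $b\ge2$), understood weakly against bounded measurable test functions of bounded support, with convergent loop integrals; for the propagator the flow equation is $\partial_kG_k=\tilde\partial_kG_k-G_k(\partial_k\Gamma^{\{1\}}_k)G_k$. Closeability. Arguments of $V_n$ are $m$-closeable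 if $m$, but not $m+1$, outgoing legs can simultaneously be joined to distinct incoming legs at strictly later times; the $m$-closeable part of $V_n$ is its restriction to such arguments. Assumptions (few-body limit, instantaneous microscopic interactions; $k$ in a set $K\subset\mathbb R$). $G_k$ and $\tilde\partial_kG_k$ vanish unless they propagate strictly forward in time. For $n\ge2$, $V_n$ is supported on allowed arguments: (i) the outgoing legs can be paired with the incoming legs so that no particle leaves before it enters; (ii) $V_2$ is non-closeable ($0$-closeable), and $V_n$ with $n\ge3$ has $m$-closeable parts only for $0\le m\le n-3$. Data satisfying this are called admissible. Sectors. The one-body sector is the propagator, the two-body sector is $V_2$, and for $n\ge3$ the $n$-body sector consists of the $m$-closeable parts of the $V_{n+m}$, $m\ge0$ (so for $m=0$ of the non-closeable part of $V_n$). Statement. (1) For $n\ge1$, the right-hand sides of the flow equations for the $n$-body sector depend only on the $j$-body sectors with $j\le n$: they coincide for any two admissible data (with the same $\partial_kR_k$) which agree in the $j$-body sectors, $1\le j\le n$, whatever the $j$-body sectors with $j>n$ are. (2) For admissible data, the right-hand side of the flow equation of $V_n$, $n\ge2$, is again supported on allowed arguments, and the right-hand side of that of $\Gamma^{\{1\}}$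 vanishes. (3) Hence the sectors can be solved successively, starting from $n=2$. An admissible family $(G_k,V_{n,k})_{k\in K}$ solves all flow equations if and only if it solves those for the $n$-body sector for every $n\ge1$. Whether it solves those for the $n$-body sector is determined by its $j$-body sectors with $j\le n$. Finally, suppose that the propagator satisfies $\partial_kG_k=\tilde\partial_kG_k$, and that for $n=2,3,\dots$ successively there is an admissible family which solves the flow equations for the $n$-body sector and has the same $j$-body sectors, $1\le j\le n-1$, as the family obtained in the previous step (for $n\ge3$; all these families have the given propagator). Then there is an admissible family which has, for every $n\ge2$, the $j$-body sectors with $j\le n$ of the $n$-th family, and which solves all flow equations. -/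

import Mathlib

open MeasureTheory

/-- A point of a leg of a vertex function: imaginary time, position in `ℝ^d`, and one of `s`
internal components of the complex bosonic field. -/
abbrev Pt (d s : ℕ) : Type := ℝ × EuclideanSpace ℝ (Fin d) × Fin s

/-- The arguments of an `n`-body vertex function: `n` outgoing legs (first component, the legs
contracted with `φ*`) and `n` incoming legs (second component, contracted with `φ`). -/
abbrev Legs (d s n : ℕ) : Type := (Fin n → Pt d s) × (Fin n → Pt d s)

/-- `m` outgoing legs can simultaneously be joined to `m` incoming legs by lines that run forward
in time (a line starts at an outgoing leg and ends at an incoming leg, strictly later). -/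
def ClosesWith {d s n : ℕ} (m : ℕ) (c : Legs d s n) : Prop :=
  ∃ a b : Fin m ↪ Fin n, ∀ l, (c.1 (a l)).1 < (c.2 (b l)).1

/-- The arguments at which a vertex function contributes to its `m`-closeable part: `m` forward
lines can be attached, but not `m + 1`. -/
def MCloseable {d s n : ℕ} (m : ℕ) (c : Legs d s n) : Prop :=
  ClosesWith m c ∧ ¬ ClosesWith (m + 1) c

/-- Particles run forward in time through the vertex: the outgoing legs can be paired with the
incoming ones so that no particle leaves before it enters. -/
def Causal {d s n : ℕ} (c : Legs d s n) : Prop :=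
  ∃ σ : Equiv.Perm (Fin n), ∀ i, (c.2 (σ i)).1 ≤ (c.1 i).1

/-- The arguments at which the `n`-body vertex functions, `n ≥ 2`, of a theory with instantaneous
microscopic interactions may be nonzero: causal ones, non-closeable for `n = 2`, and at most
`(n-3)`-closeable for `n ≥ 3`. (No argument qualifies for `n ≤ 1`.) -/
def Allowed {d s n : ℕ} (c : Legs d s n) : Prop :=
  Causal c ∧ ((n = 2 ∧ ¬ ClosesWith 1 c) ∨ (3 ≤ n ∧ ∀ m, ClosesWith m c → m + 3 ≤ n))

/-- The arguments at which the `b`-body vertex function belongs to the `n`-body sector: the whole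
two-body vertex for `n = 2`; for `n ≥ 3` the `m`-closeable part of the `(n+m)`-body vertex, `m ≥ 0`.
The one-body sector contains no vertex function with `b ≥ 2`; it is the propagator. -/
def sectorSet (d s n b : ℕ) : Set (Legs d s b) :=
  {c | (n = 2 ∧ b = 2) ∨ (3 ≤ n ∧ ∃ m, b = n + m ∧ MCloseable m c)}

/-- Points with time and position bounded by `R`. -/
def InBox {d s : ℕ} (R : ℝ) (x : Pt d s) : Prop := |x.1| ≤ R ∧ ‖x.2.1‖ ≤ R

/-- Argument tuples with all legs in the box of size `R`. -/
def legBox (d s n : ℕ) (R : ℝ) : Set (Legs d s n) :=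
  {c | (∀ i, InBox R (c.1 i)) ∧ ∀ i, InBox R (c.2 i)}

/-- An `n`-body vertex function as a generalized function: a locally finite complex measure on the
`2n` legs, symmetric in the outgoing and in the incoming legs, written in its (unique) polar form
`phase · var` with the total variation measure `var`. Measures are needed because instantaneous
and contact interactions are delta functions. -/
structure Vertex (d s n : ℕ) where
  var : Measure (Legs d s n)
  phase : Legs d s n → ℂ
  measurable_phase : Measurable phase
  norm_phase : ∀ c, ‖phase c‖ = 1
  locally_finite : ∀ R : ℝ, var (legBox d s n R) < ⊤
  var_symm : ∀ σ π : Equiv.Perm (Fin n),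
    var.map (fun c : Legs d s n => ((c.1 ∘ σ, c.2 ∘ π) : Legs d s n)) = var
  phase_symm : ∀ σ π : Equiv.Perm (Fin n), ∀ᵐ c ∂var, phase (c.1 ∘ σ, c.2 ∘ π) = phase c

/-- Pairing of a vertex function with a function of its arguments. -/
noncomputable def Vertex.pair {d s n : ℕ} (V : Vertex d s n) (f : Legs d s n → ℂ) : ℂ :=
  ∫ c, f c * V.phase c ∂V.var

/-- Test functions: bounded, measurable, with bounded support. -/
def IsTest {d s n : ℕ} (f : Legs d s n → ℂ) : Prop :=
  Measurable f ∧ (∃ C : ℝ, ∀ c, ‖f c‖ ≤ C) ∧ ∃ R : ℝ, ∀ c, f c ≠ 0 → c ∈ legBox d s n R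

/-- The data of the flowing action at one scale: the regularized propagator
`prop x y = ⟨φ(x) φ*(y)⟩ = (Γ^{1} + R)⁻¹(x, y)` and the one-particle irreducible `n`-body vertex
functions `vert n`. Only the `vert n` with `n ≥ 2` are used. -/
structure FlowState (d s : ℕ) where
  prop : Pt d s → Pt d s → ℂ
  measurable_prop : Measurable (Function.uncurry prop)
  vert : ∀ n, Vertex d s n

/-- The kernel `K ↦ (G K G)(x, y)`, as a function of the two legs of a one-body object `K`. -/
def dress {d s : ℕ} (G : Pt d s → Pt d s → ℂ) (x y : Pt d s) (c : Legs d s 1) : ℂ :=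
  G x (c.1 0) * G (c.2 0) y

/-- The regulator scale derivative of the regularized propagator (the scale derivative that acts
on the regulator only): `- G (∂ₖ Rₖ) G`, where `Rd` is the kernel `∂ₖ Rₖ`. -/
noncomputable def propDot {d s : ℕ} (Rd : Vertex d s 1) (G : Pt d s → Pt d s → ℂ)
    (x y : Pt d s) : ℂ :=
  - Rd.pair (dress G x y)

/-- Propagation only forward in time. -/
def Retarded {d s : ℕ} (G : Pt d s → Pt d s → ℂ) : Prop :=
  ∀ x y, x.1 ≤ y.1 → G x y = 0

/-- Few-body states: the regularized propagator and its regulator scale derivative (which is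
well defined) are retarded, and the vertex functions have allowed time arguments. -/
structure Admissible {d s : ℕ} (Rd : Vertex d s 1) (S : FlowState d s) : Prop where
  retarded : Retarded S.prop
  integrable_dot : ∀ x y, Integrable (fun c => dress S.prop x y c * Rd.phase c) Rd.var
  retarded_dot : Retarded (propDot Rd S.prop)
  allowed : ∀ n, 2 ≤ n → ∀ᵐ c ∂(S.vert n).var, Allowed c

/-! ### One-loop diagrams

Expansion in the fields of `∂ₖ Γₖ = ½ Tr ∂̃ₖ ln (Γₖ⁽²⁾ + Rₖ)` around the one-body part: rings of
`r` vertices `v : Fin r`, the vertex `v` being of body number `β v + 2`. The line `i` of the ring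
joins the vertices `i` and `finRotate r i`; it runs from the former to the latter if `o i = true`,
and in the opposite direction otherwise. A line starts at an outgoing and ends at an incoming leg.
By symmetry of the vertex functions the first legs may be used for the lines of the ring. -/

/-- The leg slot which line `i` uses at the vertex `finRotate r i` (slot `0`, unless the line
`finRotate r i` already occupies the slot `0` of the same kind). -/
def endSlot {r : ℕ} (o : Fin r → Bool) (β : Fin r → ℕ) (i : Fin r) : Fin (β (finRotate r i) + 2) :=
  if o (finRotate r i) = o i then 0 else 1

/-- The outgoing leg at which line `i` starts. -/
def outEnd {r : ℕ} (o : Fin r → Bool) (β : Fin r → ℕ) (i : Fin r) : Σ v, Fin (β v + 2) :=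
  if o i = true then ⟨i, 0⟩ else ⟨finRotate r i, endSlot o β i⟩

/-- The incoming leg at which line `i` ends. -/
def inEnd {r : ℕ} (o : Fin r → Bool) (β : Fin r → ℕ) (i : Fin r) : Σ v, Fin (β v + 2) :=
  if o i = true then ⟨finRotate r i, endSlot o β i⟩ else ⟨i, 0⟩

/-- The external outgoing legs of the ring. -/
abbrev ExtOut {r : ℕ} (o : Fin r → Bool) (β : Fin r → ℕ) : Type :=
  {l : Σ v, Fin (β v + 2) // ∀ i, outEnd o β i ≠ l}

/-- The external incoming legs of the ring. -/
abbrev ExtIn {r : ℕ} (o : Fin r → Bool) (β : Fin r → ℕ) : Type :=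
  {l : Σ v, Fin (β v + 2) // ∀ i, inEnd o β i ≠ l}

/-- The arguments of all the vertices of the ring. -/
abbrev RingLegs (d s : ℕ) {r : ℕ} (β : Fin r → ℕ) : Type := ∀ v, Legs d s (β v + 2)

/-- The value of a propagator on line `i` of the ring. -/
def lineVal {d s r : ℕ} (o : Fin r → Bool) (β : Fin r → ℕ) (G : Pt d s → Pt d s → ℂ)
    (x : RingLegs d s β) (i : Fin r) : ℂ :=
  G ((x (inEnd o β i).1).2 (inEnd o β i).2) ((x (outEnd o β i).1).1 (outEnd o β i).2)

/-- The external arguments of the ring, for a labelling of its external legs. -/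
def extLegs {d s r p : ℕ} (o : Fin r → Bool) (β : Fin r → ℕ) (e' : ExtOut o β ≃ Fin p)
    (e : ExtIn o β ≃ Fin p) (x : RingLegs d s β) : Legs d s p :=
  (fun i => (x (e'.symm i).1.1).1 (e'.symm i).1.2, fun i => (x (e.symm i).1.1).2 (e.symm i).1.2)

/-- The integrand of a ring: the regulator scale derivative of the product of its propagators
(each of them in turn being replaced by its derivative), times the phases of its vertices, times
a function `f` of the external legs. -/
noncomputable def ringIntegrand {d s r p : ℕ} (Rd : Vertex d s 1) (S : FlowState d s)
    (o : Fin r → Bool) (β : Fin r → ℕ) (e' : ExtOut o β ≃ Fin p) (e : ExtIn o β ≃ Fin p)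
    (f : Legs d s p → ℂ) (x : RingLegs d s β) : ℂ :=
  f (extLegs o β e' e x) * (∏ v, (S.vert (β v + 2)).phase (x v)) *
    ∑ j, lineVal o β (propDot Rd S.prop) x j * ∏ i ∈ Finset.univ.erase j, lineVal o β S.prop x i

/-- Product of the variation measures of the vertices of a ring. -/
noncomputable def ringMeasure {d s r : ℕ} (S : FlowState d s) (β : Fin r → ℕ) :
    Measure (RingLegs d s β) :=
  Measure.pi fun v => (S.vert (β v + 2)).var

/-- The combinatorial factor of a ring: `(-1)^(r+1) / (2r)` from the logarithm and the trace, and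
`1 / (a! a'!)` for each vertex with `a` incoming and `a'` outgoing external legs. -/
noncomputable def ringCoeff {r : ℕ} (o : Fin r → Bool) (β : Fin r → ℕ) : ℂ :=
  (-1) ^ (r + 1) / (2 * (r : ℂ)) *
    ∏ v, 1 / (((Fintype.card {a : Fin (β v + 2) // ∀ i, outEnd o β i ≠ ⟨v, a⟩}).factorial : ℂ) *
      ((Fintype.card {a : Fin (β v + 2) // ∀ i, inEnd o β i ≠ ⟨v, a⟩}).factorial : ℂ))

/-- The right-hand side of the flow equation of the `p`-body vertex function `V_p`, paired with
`f`; vertex functions are normalized by `Γ^{p}[φ] = (1/p!²) ∫ V_p φ*^p φ^p`. A ring with `p`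
external outgoing legs has at most `p` vertices, of body number at most `p + 1`; if the number of
external legs does not match, there are no labellings `e'`, `e`. -/
noncomputable def flowRHS {d s : ℕ} (Rd : Vertex d s 1) (S : FlowState d s) (p : ℕ)
    (f : Legs d s p → ℂ) : ℂ :=
  ∑ r ∈ Finset.Icc 1 p, ∑ o : Fin r → Bool, ∑ β : Fin r → Fin p,
    ringCoeff o (fun v => (β v : ℕ)) *
      ∑ e' : ExtOut o (fun v => (β v : ℕ)) ≃ Fin p, ∑ e : ExtIn o (fun v => (β v : ℕ)) ≃ Fin p,
        ∫ x, ringIntegrand Rd S o (fun v => (β v : ℕ)) e' e f x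
          ∂(ringMeasure S (fun v => (β v : ℕ)))

/-- All the loop integrals in `flowRHS` converge. -/
def FlowConverges {d s : ℕ} (Rd : Vertex d s 1) (S : FlowState d s) (p : ℕ)
    (f : Legs d s p → ℂ) : Prop :=
  ∀ r ∈ Finset.Icc 1 p, ∀ (o : Fin r → Bool) (β : Fin r → Fin p)
    (e' : ExtOut o (fun v => (β v : ℕ)) ≃ Fin p) (e : ExtIn o (fun v => (β v : ℕ)) ≃ Fin p),
    Integrable (ringIntegrand Rd S o (fun v => (β v : ℕ)) e' e f)
      (ringMeasure S (fun v => (β v : ℕ)))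

/-- The right-hand side of the flow equation of the regularized propagator,
`∂ₖ G = - G (∂ₖ Rₖ) G - G (∂ₖ Γ^{1}) G`. -/
noncomputable def propRHS {d s : ℕ} (Rd : Vertex d s 1) (S : FlowState d s) (x y : Pt d s) : ℂ :=
  propDot Rd S.prop x y - flowRHS Rd S 1 (dress S.prop x y)

/-! ### Sectors -/

/-- Two states have the same `n`-body sector: the same propagator if `n = 1`, and the same
vertex functions (as complex measures) on the arguments that belong to the `n`-body sector. -/
def AgreeSector {d s : ℕ} (n : ℕ) (S T : FlowState d s) : Prop :=
  (n = 1 → S.prop = T.prop) ∧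
  ∀ b, (S.vert b).var.restrict (sectorSet d s n b) = (T.vert b).var.restrict (sectorSet d s n b) ∧
    ∀ᵐ c ∂(S.vert b).var.restrict (sectorSet d s n b), (S.vert b).phase c = (T.vert b).phase c

/-- Test functions for the `b`-body vertex that test its part in the `n`-body sector only. -/
def IsSectorTest {d s b : ℕ} (n : ℕ) (f : Legs d s b → ℂ) : Prop :=
  IsTest f ∧ ∀ c, c ∉ sectorSet d s n b → f c = 0

/-- The right-hand sides of the flow equations for the `n`-body sector are the same in `S` and
`T` (including the convergence of the loop integrals). -/
def SameSectorFlow {d s : ℕ} (Rd : Vertex d s 1) (n : ℕ) (S T : FlowState d s) : Prop :=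
  (n = 1 → ∀ x y, (FlowConverges Rd S 1 (dress S.prop x y) ↔
      FlowConverges Rd T 1 (dress T.prop x y)) ∧ propRHS Rd S x y = propRHS Rd T x y) ∧
  ∀ (b : ℕ) (f : Legs d s b → ℂ), IsSectorTest n f →
    (FlowConverges Rd S b f ↔ FlowConverges Rd T b f) ∧ flowRHS Rd S b f = flowRHS Rd T b f

/-- The flow equation of the propagator holds for the scales in `K`. -/
def SolvesProp {d s : ℕ} (K : Set ℝ) (Rd : ℝ → Vertex d s 1) (Γ : ℝ → FlowState d s) : Prop :=
  ∀ k ∈ K, ∀ x y, FlowConverges (Rd k) (Γ k) 1 (dress (Γ k).prop x y) ∧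
    HasDerivWithinAt (fun l => (Γ l).prop x y) (propRHS (Rd k) (Γ k) x y) K k

/-- The flow equation of the `b`-body vertex function, paired with `f`, holds on `K`. -/
def SolvesVertex {d s b : ℕ} (K : Set ℝ) (Rd : ℝ → Vertex d s 1) (Γ : ℝ → FlowState d s)
    (f : Legs d s b → ℂ) : Prop :=
  ∀ k ∈ K, FlowConverges (Rd k) (Γ k) b f ∧
    HasDerivWithinAt (fun l => ((Γ l).vert b).pair f) (flowRHS (Rd k) (Γ k) b f) K k

/-- The flow equations for the `n`-body sector hold on `K`. -/
def SolvesSector {d s : ℕ} (K : Set ℝ) (Rd : ℝ → Vertex d s 1) (n : ℕ)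
    (Γ : ℝ → FlowState d s) : Prop :=
  (n = 1 → SolvesProp K Rd Γ) ∧
  ∀ (b : ℕ) (f : Legs d s b → ℂ), IsSectorTest n f → SolvesVertex K Rd Γ f

/-- The full system of flow equations, for the propagator and all vertex functions. -/
def SolvesFlow {d s : ℕ} (K : Set ℝ) (Rd : ℝ → Vertex d s 1) (Γ : ℝ → FlowState d s) : Prop :=
  SolvesProp K Rd Γ ∧
  ∀ b, 2 ≤ b → ∀ f : Legs d s b → ℂ, IsTest f → SolvesVertex K Rd Γ f

/-!
For the arguments `c` of a vertex, count the particles present at time `t`: the incoming legs up to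
`t` minus the outgoing legs before `t`. Let the peak of `c` be the maximum over `t`. Matching legs
in the order of their times shows that `m` lines can be closed on an `n`-body vertex if and only if
its peak is at most `n - m`. Hence the sector of an allowed argument is its peak.

In a ring, attaching forward lines adds to the particles at the vertices those that propagate along
the lines. So the peak of the external legs is at least the peak of every vertex, which is the
dependence on lower sectors only, and external arguments are causal. They are also allowed: the one
case that needs an argument is a ring of at least three two-body vertices, where some vertex
acts at a time at which a third particle propagates between two other vertices. No argument of a
one-body vertex is allowed, so the right-hand side for `Γ^{1}` vanishes.

A family that solves all flow equations takes its `b`-body vertex from the `b`-th of the successive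
solutions, which already contains all the sectors to which `V_b` contributes.
-/

open scoped Finset

section Sorting

variable {α : Type*} [LinearOrder α] {n : ℕ}

lemma card_filter_lt_sort_le (f : Fin n → α) (i : Fin n) :
    #{j | f j < f (Tuple.sort f i)} ≤ i := by
  have hsub : ({j | f j < f (Tuple.sort f i)} : Finset (Fin n)) ⊆
      (Finset.Iio i).map (Tuple.sort f).toEmbedding := fun j hj => by
    obtain ⟨k, rfl⟩ := (Tuple.sort f).surjective j
    simpa using (Tuple.monotone_sort f).reflect_lt (Finset.mem_filter.1 hj).2
  simpa using Finset.card_le_card hsub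

lemma lt_card_filter_le_sort (f : Fin n → α) (i : Fin n) :
    i < #{j | f j ≤ f (Tuple.sort f i)} := by
  have hsub : (Finset.Iic i).map (Tuple.sort f).toEmbedding ⊆
      ({j | f j ≤ f (Tuple.sort f i)} : Finset (Fin n)) := fun j hj => by
    obtain ⟨k, hk, rfl⟩ := Finset.mem_map.1 hj
    simpa using Tuple.monotone_sort f (Finset.mem_Iic.1 hk)
  simpa using Finset.card_le_card hsub

lemma exists_perm_forall_le_of_card_le {f g : Fin n → α}
    (h : ∀ t, #{i | f i ≤ t} ≤ #{i | g i ≤ t}) :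
    ∃ σ : Equiv.Perm (Fin n), ∀ i, g (σ i) ≤ f i := by
  suffices hsort : ∀ i, g (Tuple.sort g i) ≤ f (Tuple.sort f i) from
    ⟨(Tuple.sort f).symm.trans (Tuple.sort g), fun i => by
      simpa using hsort ((Tuple.sort f).symm i)⟩
  by_contra! ⟨i, hi⟩
  have hf := lt_card_filter_le_sort f i
  have hg : #{j | g j ≤ f (Tuple.sort f i)} ≤ i :=
    (Finset.card_le_card (Finset.monotone_filter_right _ fun j _ hj => hj.trans_lt hi)).trans
      (card_filter_lt_sort_le g i)
  have := h (f (Tuple.sort f i))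
  omega

-- The `m` smallest values of `f` are matched in order with the `m` largest values of `g`.
lemma exists_embeddings_forall_lt_of_card_le {f g : Fin n → α} {m : ℕ} (hm : m ≤ n)
    (h : ∀ t, #{i | g i ≤ t} + m ≤ n + #{i | f i < t}) :
    ∃ a b : Fin m ↪ Fin n, ∀ l, f (a l) < g (b l) := by
  let a : Fin m ↪ Fin n := (Fin.castLEEmb hm).trans (Tuple.sort f).toEmbedding
  let top : Fin m ↪ Fin n :=
    (Fin.natAddEmb (n - m)).trans (finCongr (Nat.sub_add_cancel hm)).toEmbedding
  refine ⟨a, top.trans (Tuple.sort g).toEmbedding, fun l => ?_⟩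
  by_contra! hl
  have hf : #{j | f j < f (a l)} ≤ l := card_filter_lt_sort_le f (Fin.castLE hm l)
  have hg : n - m + l < #{j | g j ≤ f (a l)} :=
    (lt_card_filter_le_sort g (top l)).trans_le
      (Finset.card_le_card (Finset.monotone_filter_right _ fun j _ hj => hj.trans hl))
  have := h (f (a l))
  omega

end Sorting

/-! ### Occupation numbers -/

section Occupation

variable {d s n : ℕ}

/-- The number of incoming legs with times in `I` minus the number of outgoing legs with times in
`J`. The legs are counted by indicator functions, which add up over the legs of a ring. -/
noncomputable def timeBalance (I J : Set ℝ) (c : Legs d s n) : ℤ :=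
  ∑ i, I.indicator 1 (c.2 i).1 - ∑ i, J.indicator 1 (c.1 i).1

/-- The number of particles present at time `t`, those that enter or leave at `t` included. -/
noncomputable def occupation (t : ℝ) (c : Legs d s n) : ℤ :=
  timeBalance (Set.Iic t) (Set.Iio t) c

/-- The number of particles present immediately after time `t`: those that enter at `t` are
included, those that leave at `t` are not. -/
noncomputable def occupationAfter (t : ℝ) (c : Legs d s n) : ℤ :=
  timeBalance (Set.Iic t) (Set.Iic t) c

lemma occupation_eq_card (t : ℝ) (c : Legs d s n) :
    occupation t c = #{i | (c.2 i).1 ≤ t} - #{i | (c.1 i).1 < t} := by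
  simp [occupation, timeBalance, Set.indicator_apply]

lemma occupationAfter_eq_card (t : ℝ) (c : Legs d s n) :
    occupationAfter t c = #{i | (c.2 i).1 ≤ t} - #{i | (c.1 i).1 ≤ t} := by
  simp [occupationAfter, timeBalance, Set.indicator_apply]

lemma occupation_eq_sub (t : ℝ) (c : Legs d s n) :
    occupation t c = n - (#{i | (c.1 i).1 < t} + #{i | t < (c.2 i).1}) := by
  have hcompl := Finset.card_filter_add_card_filter_not (s := .univ) fun i => (c.2 i).1 ≤ t
  simp only [not_le, Finset.card_univ, Fintype.card_fin] at hcompl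
  rw [occupation_eq_card]
  omega

lemma occupation_le_card (t : ℝ) (c : Legs d s n) : occupation t c ≤ n := by
  rw [occupation_eq_sub]
  omega

lemma le_occupation_iff {t : ℝ} {c : Legs d s n} :
    (n : ℤ) ≤ occupation t c ↔ (∀ i, (c.2 i).1 ≤ t) ∧ ∀ i, t ≤ (c.1 i).1 := by
  have hcard : (n : ℤ) ≤ occupation t c ↔ #{i | t < (c.2 i).1} = 0 ∧ #{i | (c.1 i).1 < t} = 0 := by
    rw [occupation_eq_sub]
    omega
  simpa [Finset.filter_eq_empty_iff] using hcard

lemma forall_lt_of_occupation_nonpos {t u : ℝ} {c : Legs d s n} (hu : (n : ℤ) ≤ occupation u c)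
    (ht : occupation t c ≤ 0) (hut : u < t) (i : Fin n) : (c.1 i).1 < t := by
  have hin : #{i | t < (c.2 i).1} = 0 := by
    simpa [Finset.filter_eq_empty_iff] using
      fun i => ((le_occupation_iff.1 hu).1 i).trans hut.le
  have hout : #{i | (c.1 i).1 < t} = #(Finset.univ : Finset (Fin n)) := by
    have hle := Finset.card_filter_le .univ fun i => (c.1 i).1 < t
    rw [occupation_eq_sub] at ht
    simp only [Finset.card_univ, Fintype.card_fin] at hle ⊢
    omega
  exact Finset.card_filter_eq_iff.1 hout i (Finset.mem_univ i)

lemma forall_gt_of_occupation_nonpos {t u : ℝ} {c : Legs d s n} (hu : (n : ℤ) ≤ occupation u c)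
    (ht : occupation t c ≤ 0) (htu : t < u) (i : Fin n) : t < (c.2 i).1 := by
  have hout : #{i | (c.1 i).1 < t} = 0 := by
    simpa [Finset.filter_eq_empty_iff] using
      fun i => htu.le.trans ((le_occupation_iff.1 hu).2 i)
  have hin : #{i | t < (c.2 i).1} = #(Finset.univ : Finset (Fin n)) := by
    have hle := Finset.card_filter_le .univ fun i => t < (c.2 i).1
    rw [occupation_eq_sub] at ht
    simp only [Finset.card_univ, Fintype.card_fin] at hle ⊢
    omega
  exact Finset.card_filter_eq_iff.1 hin i (Finset.mem_univ i)

lemma causal_iff_forall_occupationAfter_nonneg {c : Legs d s n} :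
    Causal c ↔ ∀ t, 0 ≤ occupationAfter t c := by
  simp only [occupationAfter_eq_card, sub_nonneg, Nat.cast_le]
  refine ⟨fun ⟨σ, hσ⟩ t => ?_, exists_perm_forall_le_of_card_le⟩
  exact Finset.card_le_card_of_injOn σ
    (fun i hi => by simpa using (hσ i).trans (Finset.mem_filter.1 hi).2) σ.injective.injOn

lemma Causal.occupation_nonneg {c : Legs d s n} (hc : Causal c) (t : ℝ) : 0 ≤ occupation t c := by
  have hafter := causal_iff_forall_occupationAfter_nonneg.1 hc t
  have hle : #{i | (c.1 i).1 < t} ≤ #{i | (c.1 i).1 ≤ t} :=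
    Finset.card_le_card (Finset.monotone_filter_right _ fun _ _ => le_of_lt)
  rw [occupationAfter_eq_card] at hafter
  rw [occupation_eq_card]
  omega

lemma ClosesWith.occupation_add_le {m : ℕ} {c : Legs d s n} (hc : ClosesWith m c) (t : ℝ) :
    occupation t c + m ≤ n := by
  obtain ⟨a, b, hab⟩ := hc
  have hout : #{l | (c.1 (a l)).1 < t} ≤ #{i | (c.1 i).1 < t} :=
    Finset.card_le_card_of_injOn a (fun l hl => by simpa using hl) a.injective.injOn
  have hin : #{l | ¬ (c.1 (a l)).1 < t} ≤ #{i | t < (c.2 i).1} :=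
    Finset.card_le_card_of_injOn b
      (fun l hl => by simpa using (not_lt.1 (Finset.mem_filter.1 hl).2).trans_lt (hab l))
      b.injective.injOn
  have hcompl := Finset.card_filter_add_card_filter_not (s := .univ) fun l => (c.1 (a l)).1 < t
  simp only [Finset.card_univ, Fintype.card_fin] at hcompl
  rw [occupation_eq_sub]
  omega

/-- The largest number of particles present at the same time. The supremum is attained, since
occupation numbers are at most `n`; negative ones, which occur at arguments that are not causal,
are truncated to `0`. -/
noncomputable def peak (c : Legs d s n) : ℕ := ⨆ t, (occupation t c).toNat

lemma peak_le_iff {c : Legs d s n} {k : ℕ} : peak c ≤ k ↔ ∀ t, occupation t c ≤ k := by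
  have hbdd : BddAbove (Set.range fun t => (occupation t c).toNat) :=
    ⟨n, Set.forall_mem_range.2 fun t => Int.toNat_le.2 (occupation_le_card t c)⟩
  simp only [peak, ciSup_le_iff hbdd, Int.toNat_le]

lemma lt_peak_iff {c : Legs d s n} {k : ℕ} : k < peak c ↔ ∃ t, (k : ℤ) < occupation t c := by
  simpa using (peak_le_iff (c := c) (k := k)).not

lemma occupation_le_peak (t : ℝ) (c : Legs d s n) : occupation t c ≤ peak c :=
  peak_le_iff.1 le_rfl t

lemma peak_le_card (c : Legs d s n) : peak c ≤ n :=
  peak_le_iff.2 fun t => occupation_le_card t c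

theorem closesWith_iff {m : ℕ} {c : Legs d s n} : ClosesWith m c ↔ peak c + m ≤ n := by
  constructor
  · intro hc
    have hm : m ≤ n := by
      obtain ⟨a, -, -⟩ := hc
      simpa using Fintype.card_le_of_embedding a
    have hpeak : peak c ≤ n - m := peak_le_iff.2 fun t => by
      have := hc.occupation_add_le t
      omega
    omega
  · intro h
    refine exists_embeddings_forall_lt_of_card_le (f := fun i => (c.1 i).1)
      (g := fun i => (c.2 i).1) (by omega) fun t => ?_
    have := occupation_le_peak t c
    rw [occupation_eq_card] at this
    omega

lemma mCloseable_iff {m : ℕ} {c : Legs d s n} : MCloseable m c ↔ peak c + m = n := by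
  simp only [MCloseable, closesWith_iff]
  omega

theorem allowed_iff {c : Legs d s n} :
    Allowed c ↔ Causal c ∧ 2 ≤ peak c ∧ (n = 2 ∨ 3 ≤ peak c) := by
  have hle := peak_le_card c
  have hcloses : (∀ m, ClosesWith m c → m + 3 ≤ n) ↔ 3 ≤ peak c := by
    simp only [closesWith_iff]
    exact ⟨fun h => by have := h (n - peak c) (by omega); omega, fun h m hm => by omega⟩
  rw [Allowed, hcloses, closesWith_iff]
  refine and_congr_right fun _ => ?_
  omega

lemma mem_sectorSet_iff {j : ℕ} {c : Legs d s n} :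
    c ∈ sectorSet d s j n ↔ (j = 2 ∧ n = 2) ∨ (3 ≤ j ∧ peak c = j) := by
  have hle := peak_le_card c
  have hparts : (∃ m, n = j + m ∧ MCloseable m c) ↔ peak c = j := by
    simp only [mCloseable_iff]
    exact ⟨fun ⟨_, _, _⟩ => by omega, fun h => ⟨n - j, by omega, by omega⟩⟩
  rw [sectorSet, Set.mem_ofPred_eq, hparts]

lemma peak_le_of_mem_sectorSet {j : ℕ} {c : Legs d s n} (hc : c ∈ sectorSet d s j n) :
    peak c ≤ j := by
  have hle := peak_le_card c
  have := mem_sectorSet_iff.1 hc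
  omega

lemma sectorSet_eq_empty {j : ℕ} (h : j < 2 ∨ n < j) : sectorSet d s j n = ∅ := by
  refine Set.eq_empty_of_forall_notMem fun c hc => ?_
  have hle := peak_le_card c
  have := mem_sectorSet_iff.1 hc
  omega

theorem Allowed.mem_sectorSet_iff {j : ℕ} {c : Legs d s n} (hc : Allowed c) :
    c ∈ sectorSet d s j n ↔ peak c = j := by
  have hle := peak_le_card c
  have hpeak := (allowed_iff.1 hc).2
  rw [_root_.mem_sectorSet_iff]
  omega

end Occupation

/-! ### Rings -/

lemma finRotate_ne_self {r : ℕ} (hr : 2 ≤ r) (i : Fin r) : finRotate r i ≠ i := by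
  obtain ⟨k, rfl⟩ := Nat.exists_eq_add_of_le' hr
  simp [finRotate_apply]

lemma finRotate_finRotate_ne_self {r : ℕ} (hr : 3 ≤ r) (i : Fin r) :
    finRotate r (finRotate r i) ≠ i := by
  obtain ⟨k, rfl⟩ := Nat.exists_eq_add_of_le' hr
  have hval : ((1 + 1 : Fin (k + 3)) : ℕ) = 2 := by
    rw [Fin.val_add, Fin.val_one, Nat.mod_eq_of_lt (by omega)]
  simp [finRotate_apply, add_assoc, Fin.ext_iff, -Fin.val_eq_zero_iff, hval]

-- The smaller neighbour of the minimum lies between the minimum and its other neighbour.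
lemma exists_between_cyclic_neighbors {α : Type*} [LinearOrder α] {r : ℕ} (hr : 3 ≤ r)
    {T : Fin r → α} (hT : Function.Injective T) :
    ∃ i v, (T i < T v ∧ T v < T (finRotate r i)) ∨ (T (finRotate r i) < T v ∧ T v < T i) := by
  have : Nonempty (Fin r) := ⟨⟨0, by omega⟩⟩
  obtain ⟨a, hmin⟩ := Finite.exists_min T
  have hlt : ∀ v, v ≠ a → T a < T v := fun v hv => (hmin v).lt_of_ne (hT.ne hv.symm)
  obtain ⟨z, rfl⟩ := (finRotate r).surjective a
  have hprev := hlt z (finRotate_ne_self (by omega) z).symm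
  have hnext := hlt _ (finRotate_ne_self (by omega) (finRotate r z))
  rcases lt_or_gt_of_ne (hT.ne (finRotate_finRotate_ne_self hr z)) with h | h
  · exact ⟨z, _, Or.inr ⟨hnext, h⟩⟩
  · exact ⟨finRotate r z, z, Or.inl ⟨hprev, h⟩⟩

lemma sum_notMem_range_add_sum {ι α M : Type*} [Fintype ι] [Fintype α] [AddCommMonoid M]
    {f : ι → α} [Fintype {a // ∀ i, f i ≠ a}] (hf : Function.Injective f) (h : α → M) :
    ∑ a : {a // ∀ i, f i ≠ a}, h a + ∑ i, h (f i) = ∑ a, h a := by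
  classical
  rw [← Finset.sum_image (s := Finset.univ) (g := f) (f := h) hf.injOn,
    ← Finset.sum_subtype (Finset.univ.image f)ᶜ (by simp) h, Finset.sum_compl_add_sum]

section Rings

variable {d s r p : ℕ}

lemma outEnd_injective (o : Fin r → Bool) (β : Fin r → ℕ) : Function.Injective (outEnd o β) := by
  intro i j h
  have hfst := congrArg Sigma.fst h
  unfold outEnd endSlot at h hfst
  cases hi : o i <;> cases hj : o j <;>
    simp only [hi, hj, if_true, Bool.false_eq_true, if_false] at h hfst
  · exact (finRotate r).injective hfst
  · subst hfst
    simp [hj, -finRotate_apply] at h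
  · subst hfst
    simp [hi, -finRotate_apply] at h
  · exact hfst

lemma inEnd_eq_outEnd_not (o : Fin r → Bool) (β : Fin r → ℕ) :
    inEnd o β = outEnd (fun i => !o i) β := by
  funext i
  cases hi : o i <;> simp [inEnd, outEnd, endSlot, hi]

lemma inEnd_injective (o : Fin r → Bool) (β : Fin r → ℕ) : Function.Injective (inEnd o β) :=
  inEnd_eq_outEnd_not o β ▸ outEnd_injective _ β

lemma outEnd_fst_inEnd_fst (o : Fin r → Bool) (β : Fin r → ℕ) (i : Fin r) :
    ((outEnd o β i).1 = i ∧ (inEnd o β i).1 = finRotate r i) ∨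
      ((outEnd o β i).1 = finRotate r i ∧ (inEnd o β i).1 = i) := by
  unfold outEnd inEnd
  split_ifs <;> simp

lemma add_eq_sum_of_extOut_equiv {o : Fin r → Bool} {β : Fin r → ℕ} (e' : ExtOut o β ≃ Fin p) :
    p + r = ∑ v, (β v + 2) := by
  have hsum := sum_notMem_range_add_sum (outEnd_injective o β) fun _ => 1
  have hcard := Fintype.card_congr e'
  simp only [Finset.sum_const, Finset.card_univ, Fintype.card_fin, Fintype.card_sigma,
    smul_eq_mul, mul_one] at hsum hcard
  rwa [hcard] at hsum

/-- The time of the outgoing leg at which line `i` of a ring starts. -/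
def startTime (o : Fin r → Bool) (β : Fin r → ℕ) (x : RingLegs d s β) (i : Fin r) : ℝ :=
  ((x (outEnd o β i).1).1 (outEnd o β i).2).1

/-- The time of the incoming leg at which line `i` of a ring ends. -/
def endTime (o : Fin r → Bool) (β : Fin r → ℕ) (x : RingLegs d s β) (i : Fin r) : ℝ :=
  ((x (inEnd o β i).1).2 (inEnd o β i).2).1

/-- All the lines of the ring run forward in time. -/
def ForwardLines (o : Fin r → Bool) (β : Fin r → ℕ) (x : RingLegs d s β) : Prop :=
  ∀ i, startTime o β x i < endTime o β x i

variable {o : Fin r → Bool} {β : Fin r → ℕ} {x : RingLegs d s β}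

lemma timeBalance_extLegs (I J : Set ℝ) (x : RingLegs d s β) (e' : ExtOut o β ≃ Fin p)
    (e : ExtIn o β ≃ Fin p) :
    timeBalance I J (extLegs o β e' e x) = ∑ v, timeBalance I J (x v) +
      ∑ i, (J.indicator 1 (startTime o β x i) - I.indicator 1 (endTime o β x i)) := by
  have hin := sum_notMem_range_add_sum (inEnd_injective o β)
    fun l => I.indicator (1 : ℝ → ℤ) ((x l.1).2 l.2).1
  have hout := sum_notMem_range_add_sum (outEnd_injective o β)
    fun l => J.indicator (1 : ℝ → ℤ) ((x l.1).1 l.2).1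
  rw [Fintype.sum_sigma] at hin hout
  simp only [timeBalance, extLegs, startTime, endTime, Finset.sum_sub_distrib]
  rw [Equiv.sum_comp e.symm fun l : ExtIn o β => I.indicator (1 : ℝ → ℤ) ((x l.1.1).2 l.1.2).1,
    Equiv.sum_comp e'.symm fun l : ExtOut o β => J.indicator (1 : ℝ → ℤ) ((x l.1.1).1 l.1.2).1]
  linarith

namespace ForwardLines

theorem occupation_extLegs (hl : ForwardLines o β x) (e' : ExtOut o β ≃ Fin p)
    (e : ExtIn o β ≃ Fin p) (t : ℝ) :
    occupation t (extLegs o β e' e x) = ∑ v, occupation t (x v) +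
      ∑ i, (Set.Ioo (startTime o β x i) (endTime o β x i)).indicator 1 t := by
  simp only [occupation, timeBalance_extLegs]
  congr! 2 with i
  have := hl i
  simp only [Set.indicator_apply, Set.mem_Iio, Set.mem_Iic, Set.mem_Ioo, Pi.one_apply]
  grind

lemma causal_extLegs (hl : ForwardLines o β x) (hx : ∀ v, Causal (x v))
    (e' : ExtOut o β ≃ Fin p) (e : ExtIn o β ≃ Fin p) : Causal (extLegs o β e' e x) := by
  simp only [causal_iff_forall_occupationAfter_nonneg, occupationAfter] at hx ⊢
  intro t
  rw [timeBalance_extLegs]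
  refine add_nonneg (Finset.sum_nonneg fun v _ => hx v t)
    (Finset.sum_nonneg fun i _ => sub_nonneg.2 ?_)
  have := hl i
  simp only [Set.indicator_apply, Set.mem_Iic, Pi.one_apply]
  grind

lemma sum_occupation_add_sum_le (hl : ForwardLines o β x) (hx : ∀ v, Causal (x v))
    (e' : ExtOut o β ≃ Fin p) (e : ExtIn o β ≃ Fin p) (vertices lines : Finset (Fin r)) (t : ℝ) :
    ∑ v ∈ vertices, occupation t (x v) +
        ∑ i ∈ lines, (Set.Ioo (startTime o β x i) (endTime o β x i)).indicator 1 t ≤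
      occupation t (extLegs o β e' e x) := by
  rw [hl.occupation_extLegs]
  exact add_le_add
    (Finset.sum_le_univ_sum_of_nonneg fun v => (hx v).occupation_nonneg t)
    (Finset.sum_le_univ_sum_of_nonneg fun i => Set.indicator_nonneg (fun _ _ => zero_le_one) t)

theorem peak_le_peak_extLegs (hl : ForwardLines o β x) (hx : ∀ v, Causal (x v))
    (e' : ExtOut o β ≃ Fin p) (e : ExtIn o β ≃ Fin p) (v : Fin r) :
    peak (x v) ≤ peak (extLegs o β e' e x) :=
  peak_le_iff.2 fun t => by
    have := hl.sum_occupation_add_sum_le hx e' e {v} ∅ t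
    rw [Finset.sum_singleton, Finset.sum_empty, add_zero] at this
    exact this.trans (occupation_le_peak t _)

lemma occupation_add_occupation_le (hl : ForwardLines o β x) (hx : ∀ v, Causal (x v))
    (e' : ExtOut o β ≃ Fin p) (e : ExtIn o β ≃ Fin p) {v w : Fin r} (hvw : v ≠ w) (t : ℝ) :
    occupation t (x v) + occupation t (x w) ≤ peak (extLegs o β e' e x) := by
  have := hl.sum_occupation_add_sum_le hx e' e {v, w} ∅ t
  rw [Finset.sum_pair hvw, Finset.sum_empty, add_zero] at this
  exact this.trans (occupation_le_peak t _)

lemma occupation_add_one_le (hl : ForwardLines o β x) (hx : ∀ v, Causal (x v))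
    (e' : ExtOut o β ≃ Fin p) (e : ExtIn o β ≃ Fin p) (v : Fin r) {i : Fin r} {t : ℝ}
    (hstart : startTime o β x i < t) (hend : t < endTime o β x i) :
    occupation t (x v) + 1 ≤ peak (extLegs o β e' e x) := by
  have := hl.sum_occupation_add_sum_le hx e' e {v} {i} t
  rw [Finset.sum_singleton, Finset.sum_singleton,
    Set.indicator_of_mem (Set.mem_Ioo.2 ⟨hstart, hend⟩), Pi.one_apply] at this
  exact this.trans (occupation_le_peak t _)

-- Every vertex has a time `T v` at which all its particles are present. If the claim fails, these
-- times are distinct, and at the time of one of the two neighbours of the earliest vertex the line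
-- between the earliest vertex and its other neighbour is under way.
theorem three_le_peak_extLegs (hl : ForwardLines o β x) (hx : ∀ v, Causal (x v))
    (hfull : ∀ v, peak (x v) = β v + 2) (hr : 3 ≤ r) (e' : ExtOut o β ≃ Fin p)
    (e : ExtIn o β ≃ Fin p) : 3 ≤ peak (extLegs o β e' e x) := by
  by_contra! hlt
  have hmeet : ∀ v, ∃ t, ((β v + 2 : ℕ) : ℤ) ≤ occupation t (x v) := fun v => by
    obtain ⟨t, ht⟩ := lt_peak_iff.1 (show β v + 1 < peak (x v) by rw [hfull v]; omega)
    exact ⟨t, by push_cast at ht ⊢; omega⟩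
  choose T hT using hmeet
  have hidle : ∀ v w, v ≠ w → occupation (T v) (x w) ≤ 0 := fun v w hvw => by
    have := hl.occupation_add_occupation_le hx e' e hvw (T v)
    have := hT v
    omega
  have hinj : Function.Injective T := fun v w hvw => by
    by_contra hne
    have := hidle v w hne
    have := hT w
    rw [← hvw] at this
    omega
  have hdir : ∀ i, T (outEnd o β i).1 < T (inEnd o β i).1 := fun i =>
    ((le_occupation_iff.1 (hT _)).2 _).trans_lt ((hl i).trans_le ((le_occupation_iff.1 (hT _)).1 _))
  obtain ⟨i, v, hiv⟩ := exists_between_cyclic_neighbors hr hinj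
  obtain ⟨hout, hin⟩ : T (outEnd o β i).1 < T v ∧ T v < T (inEnd o β i).1 := by
    have hd := hdir i
    rcases outEnd_fst_inEnd_fst o β i with ⟨ho, hi⟩ | ⟨ho, hi⟩ <;> rw [ho, hi] at hd ⊢ <;> grind
  have hstart : startTime o β x i < T v :=
    forall_lt_of_occupation_nonpos (hT _) (hidle v _ fun h => hout.ne (h ▸ rfl)) hout _
  have hend : T v < endTime o β x i :=
    forall_gt_of_occupation_nonpos (hT _) (hidle v _ fun h => hin.ne (h ▸ rfl)) hin _
  have := hl.occupation_add_one_le hx e' e v hstart hend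
  have := hT v
  omega

theorem allowed_extLegs (hl : ForwardLines o β x) (hx : ∀ v, Allowed (x v)) (hr : 1 ≤ r)
    (e' : ExtOut o β ≃ Fin p) (e : ExtIn o β ≃ Fin p) : Allowed (extLegs o β e' e x) := by
  have hc : ∀ v, Causal (x v) := fun v => (hx v).1
  have hpeak := hl.peak_le_peak_extLegs hc e' e
  have htwo : ∀ v, 2 ≤ peak (x v) := fun v => (allowed_iff.1 (hx v)).2.1
  refine allowed_iff.2 ⟨hl.causal_extLegs hc e' e, (htwo ⟨0, hr⟩).trans (hpeak _), ?_⟩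
  by_cases hβ : ∀ v, β v + 2 = 2
  · have hp : p = r := by
      have := add_eq_sum_of_extOut_equiv e'
      simp only [hβ, Finset.sum_const, Finset.card_univ, Fintype.card_fin, smul_eq_mul] at this
      omega
    have hfull : ∀ v, peak (x v) = β v + 2 := fun v =>
      (peak_le_card _).antisymm ((hβ v).trans_le (htwo v))
    have htwo_ext := (htwo ⟨0, hr⟩).trans ((hpeak _).trans (peak_le_card _))
    rcases htwo_ext.eq_or_lt' with h2 | h3
    · exact Or.inl h2
    · exact Or.inr (hl.three_le_peak_extLegs hc hfull (hp ▸ h3) e' e)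
  · push Not at hβ
    obtain ⟨v, hv⟩ := hβ
    exact Or.inr (((allowed_iff.1 (hx v)).2.2.resolve_left hv).trans (hpeak v))

end ForwardLines

end Rings

/-! ### Test functions -/

section TestFunctions

variable {d s n : ℕ}

lemma measurableSet_closesWith (m : ℕ) : MeasurableSet {c : Legs d s n | ClosesWith m c} := by
  simp only [ClosesWith, Set.ofPred_exists, Set.ofPred_forall]
  exact .iUnion fun a => .iUnion fun b => .iInter fun l =>
    measurableSet_lt (by fun_prop) (by fun_prop)

lemma measurableSet_sectorSet (j b : ℕ) : MeasurableSet (sectorSet d s j b) := by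
  simp only [sectorSet, MCloseable, Set.ofPred_or, Set.ofPred_and, Set.ofPred_exists]
  exact ((MeasurableSet.const _).inter (.const _)).union
    ((MeasurableSet.const _).inter (.iUnion fun m => (MeasurableSet.const _).inter
      ((measurableSet_closesWith m).inter (measurableSet_closesWith (m + 1)).compl)))

lemma eventually_mem_legBox (c : Legs d s n) : ∀ᶠ R in Filter.atTop, c ∈ legBox d s n R := by
  have hbox (x : Pt d s) : ∀ᶠ R in Filter.atTop, InBox R x :=
    (Filter.eventually_ge_atTop |x.1|).and (Filter.eventually_ge_atTop ‖x.2.1‖)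
  exact (Filter.eventually_all.2 fun i => hbox (c.1 i)).and
    (Filter.eventually_all.2 fun i => hbox (c.2 i))

instance Vertex.sigmaFinite_var (V : Vertex d s n) : SigmaFinite V.var :=
  ⟨⟨{ set := fun R : ℕ => legBox d s n R
      set_mem := fun _ => trivial
      finite := fun R => V.locally_finite R
      spanning := Set.iUnion_eq_univ_iff.2 fun c =>
        (tendsto_natCast_atTop_atTop.eventually (eventually_mem_legBox c)).exists }⟩⟩

lemma legBox_mono {R R' : ℝ} (h : R ≤ R') : legBox d s n R ⊆ legBox d s n R' := fun _ hc =>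
  ⟨fun i => ⟨(hc.1 i).1.trans h, (hc.1 i).2.trans h⟩,
    fun i => ⟨(hc.2 i).1.trans h, (hc.2 i).2.trans h⟩⟩

lemma isTest_zero : IsTest (0 : Legs d s n → ℂ) :=
  ⟨measurable_zero, ⟨0, by simp⟩, 0, by simp⟩

namespace IsTest

variable {f g : Legs d s n → ℂ}

lemma add (hf : IsTest f) (hg : IsTest g) : IsTest (f + g) := by
  obtain ⟨hf_meas, ⟨C, hC⟩, R, hR⟩ := hf
  obtain ⟨hg_meas, ⟨C', hC'⟩, R', hR'⟩ := hg
  refine ⟨hf_meas.add hg_meas,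
    ⟨C + C', fun c => (norm_add_le _ _).trans (add_le_add (hC c) (hC' c))⟩,
    max R R', fun c hc => ?_⟩
  by_cases hfc : f c = 0
  · exact legBox_mono (le_max_right _ _) (hR' c fun hgc => hc (by simp [hfc, hgc]))
  · exact legBox_mono (le_max_left _ _) (hR c hfc)

lemma indicator (hf : IsTest f) {A : Set (Legs d s n)} (hA : MeasurableSet A) :
    IsTest (A.indicator f) := by
  obtain ⟨hf_meas, ⟨C, hC⟩, R, hR⟩ := hf
  exact ⟨hf_meas.indicator hA, ⟨C, fun c => (norm_indicator_le_norm_self f c).trans (hC c)⟩, R,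
    fun c hc => hR c fun hfc => hc (by simp [Set.indicator, hfc])⟩

lemma isSectorTest_indicator (hf : IsTest f) (j : ℕ) :
    IsSectorTest j ((sectorSet d s j n).indicator f) :=
  ⟨hf.indicator (measurableSet_sectorSet j n), fun _ hc => Set.indicator_of_notMem hc f⟩

lemma integrable (hf : IsTest f) (V : Vertex d s n) :
    Integrable (fun c => f c * V.phase c) V.var := by
  obtain ⟨hf_meas, ⟨C, hC⟩, R, hR⟩ := hf
  have hon : IntegrableOn (fun c => f c * V.phase c) (legBox d s n R) V.var :=
    Measure.integrableOn_of_bounded (M := C) (V.locally_finite R).ne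
      (hf_meas.mul V.measurable_phase).aestronglyMeasurable
      (.of_forall fun c => by rw [norm_mul, V.norm_phase, mul_one]; exact hC c)
  exact (integrableOn_iff_integrable_of_support_subset fun c hc =>
    hR c (left_ne_zero_of_mul hc)).1 hon

end IsTest

lemma IsSectorTest.eq_zero {j : ℕ} {f : Legs d s n → ℂ} (hf : IsSectorTest j f)
    (h : j < 2 ∨ n < j) : f = 0 :=
  funext fun c => hf.2 c (by simp [sectorSet_eq_empty h])

lemma Allowed.sum_indicator_sectorSet {c : Legs d s n} (hc : Allowed c) (f : Legs d s n → ℂ) :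
    (∑ j ∈ Finset.Icc 1 n, (sectorSet d s j n).indicator f) c = f c := by
  have hpeak : peak c ∈ Finset.Icc 1 n :=
    Finset.mem_Icc.2 ⟨one_le_two.trans (allowed_iff.1 hc).2.1, peak_le_card c⟩
  rw [Finset.sum_apply, Finset.sum_eq_single_of_mem _ hpeak]
  · exact Set.indicator_of_mem (hc.mem_sectorSet_iff.2 rfl) f
  · exact fun j _ hj =>
      Set.indicator_of_notMem (fun hmem => hj (hc.mem_sectorSet_iff.1 hmem).symm) f

lemma Vertex.pair_add (V : Vertex d s n) {f g : Legs d s n → ℂ} (hf : IsTest f)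
    (hg : IsTest g) : V.pair (f + g) = V.pair f + V.pair g := by
  simp only [Vertex.pair, Pi.add_apply, add_mul, integral_add (hf.integrable V) (hg.integrable V)]

lemma Admissible.pair_congr {Rd : Vertex d s 1} {S : FlowState d s} (hS : Admissible Rd S)
    (hn : 2 ≤ n) {f g : Legs d s n → ℂ} (hfg : ∀ c, Allowed c → f c = g c) :
    (S.vert n).pair f = (S.vert n).pair g :=
  integral_congr_ae <| (hS.allowed n hn).mono fun c hc => by simp only [hfg c hc]

end TestFunctions

/-! ### Ring integrals -/

section RingIntegrals

variable {d s r p : ℕ} {Rd : Vertex d s 1} {S : FlowState d s} {o : Fin r → Bool} {β : Fin r → ℕ}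
  {e' : ExtOut o β ≃ Fin p} {e : ExtIn o β ≃ Fin p} {f g : Legs d s p → ℂ}

lemma ringIntegrand_zero : ringIntegrand Rd S o β e' e 0 = 0 := by
  funext x
  simp [ringIntegrand]

lemma ringIntegrand_add : ringIntegrand Rd S o β e' e (f + g) =
    ringIntegrand Rd S o β e' e f + ringIntegrand Rd S o β e' e g := by
  funext x
  simp only [ringIntegrand, Pi.add_apply, add_mul]

lemma flowConverges_zero : FlowConverges Rd S p 0 := fun r _ o β e' e => by
  rw [ringIntegrand_zero]
  exact integrable_zero _ _ _

lemma flowRHS_zero : flowRHS Rd S p 0 = 0 := by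
  simp [flowRHS, ringIntegrand_zero]

lemma FlowConverges.add (hf : FlowConverges Rd S p f) (hg : FlowConverges Rd S p g) :
    FlowConverges Rd S p (f + g) := fun r hr o β e' e => by
  rw [ringIntegrand_add]
  exact (hf r hr o β e' e).add (hg r hr o β e' e)

lemma flowRHS_add (hf : FlowConverges Rd S p f) (hg : FlowConverges Rd S p g) :
    flowRHS Rd S p (f + g) = flowRHS Rd S p f + flowRHS Rd S p g := by
  simp only [flowRHS, ← Finset.sum_add_distrib, ← mul_add]
  congr! 6 with r hr o _ β _ e' _ e _
  rw [ringIntegrand_add]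
  exact integral_add (hf r hr o β e' e) (hg r hr o β e' e)

lemma Retarded.lineVal_eq_zero {G : Pt d s → Pt d s → ℂ} (hG : Retarded G) {x : RingLegs d s β}
    {i : Fin r} (h : endTime o β x i ≤ startTime o β x i) : lineVal o β G x i = 0 :=
  hG _ _ h

namespace Admissible

lemma forwardLines (hS : Admissible Rd S) {x : RingLegs d s β}
    (h : ringIntegrand Rd S o β e' e f x ≠ 0) : ForwardLines o β x := by
  obtain ⟨j, -, hj⟩ := Finset.exists_ne_zero_of_sum_ne_zero (right_ne_zero_of_mul h)
  intro i
  by_contra! hi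
  by_cases hij : i = j
  · exact left_ne_zero_of_mul hj (hij ▸ hS.retarded_dot.lineVal_eq_zero hi)
  · exact right_ne_zero_of_mul hj (Finset.prod_eq_zero (Finset.mem_erase.2 ⟨hij, Finset.mem_univ i⟩)
      (hS.retarded.lineVal_eq_zero hi))

lemma ae_allowed (hS : Admissible Rd S) (β : Fin r → ℕ) :
    ∀ᵐ x ∂ringMeasure S β, ∀ v, Allowed (x v) :=
  ae_all_iff.2 fun v => Measure.tendsto_eval_ae_ae.eventually (hS.allowed (β v + 2) (by omega))

lemma ringIntegrand_congr (hS : Admissible Rd S) (hr : 1 ≤ r) (hfg : ∀ c, Allowed c → f c = g c) :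
    ringIntegrand Rd S o β e' e f =ᵐ[ringMeasure S β] ringIntegrand Rd S o β e' e g := by
  filter_upwards [hS.ae_allowed β] with x hx
  by_cases hl : ForwardLines o β x
  · simp only [ringIntegrand, hfg _ (hl.allowed_extLegs hx hr e' e)]
  · rw [not_not.1 (mt hS.forwardLines hl), not_not.1 (mt hS.forwardLines hl)]

lemma flowConverges_congr (hS : Admissible Rd S) (hfg : ∀ c, Allowed c → f c = g c)
    (hf : FlowConverges Rd S p f) : FlowConverges Rd S p g := fun r hr o β e' e =>
  (hf r hr o β e' e).congr (hS.ringIntegrand_congr (Finset.mem_Icc.1 hr).1 hfg)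

lemma flowRHS_congr (hS : Admissible Rd S) (hfg : ∀ c, Allowed c → f c = g c) :
    flowRHS Rd S p f = flowRHS Rd S p g := by
  unfold flowRHS
  congr! 6 with r hr o _ β _ e' _ e _
  exact integral_congr_ae (hS.ringIntegrand_congr (Finset.mem_Icc.1 hr).1 hfg)

theorem flowRHS_eq_zero (hS : Admissible Rd S) (hf : ∀ c, Allowed c → f c = 0) :
    flowRHS Rd S p f = 0 :=
  (hS.flowRHS_congr hf).trans flowRHS_zero

end Admissible

lemma not_allowed_one (c : Legs d s 1) : ¬ Allowed c := fun hc => by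
  have := peak_le_card c
  have := (allowed_iff.1 hc).2.1
  omega

lemma Admissible.flowConverges_one (hS : Admissible Rd S) (f : Legs d s 1 → ℂ) :
    FlowConverges Rd S 1 f :=
  hS.flowConverges_congr (fun c hc => absurd hc (not_allowed_one c)) flowConverges_zero

lemma Admissible.propRHS_eq_propDot (hS : Admissible Rd S) (x y : Pt d s) :
    propRHS Rd S x y = propDot Rd S.prop x y := by
  rw [propRHS, hS.flowRHS_eq_zero fun c hc => absurd hc (not_allowed_one c), sub_zero]

end RingIntegrals

/-! ### Dependence on the sectors -/

section RestrictEq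

variable {α E : Type*} [MeasurableSpace α] [NormedAddCommGroup E] {μ ν : Measure α} {A : Set α}
  {f g : α → E}

lemma integrable_iff_of_restrict_eq (hμν : μ.restrict A = ν.restrict A)
    (hfg : f =ᵐ[μ.restrict A] g) (hf : ∀ᵐ x ∂μ, x ∉ A → f x = 0)
    (hg : ∀ᵐ x ∂ν, x ∉ A → g x = 0) : Integrable f μ ↔ Integrable g ν :=
  calc Integrable f μ
    _ ↔ IntegrableOn f A μ := ⟨(·.integrableOn), (·.integrable_of_ae_notMem_eq_zero hf)⟩
    _ ↔ IntegrableOn g A ν := by rw [IntegrableOn, IntegrableOn, ← hμν, integrable_congr hfg]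
    _ ↔ Integrable g ν := ⟨(·.integrable_of_ae_notMem_eq_zero hg), (·.integrableOn)⟩

lemma integral_eq_of_restrict_eq [NormedSpace ℝ E] (hμν : μ.restrict A = ν.restrict A)
    (hfg : f =ᵐ[μ.restrict A] g) (hf : ∀ᵐ x ∂μ, x ∉ A → f x = 0)
    (hg : ∀ᵐ x ∂ν, x ∉ A → g x = 0) : ∫ x, f x ∂μ = ∫ x, g x ∂ν := by
  rw [← setIntegral_eq_integral_of_ae_compl_eq_zero hf,
    ← setIntegral_eq_integral_of_ae_compl_eq_zero hg, ← hμν, integral_congr_ae hfg]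

end RestrictEq

section Dependence

variable {d s r p n : ℕ} {Rd : Vertex d s 1} {S T U : FlowState d s}

namespace AgreeSector

lemma refl (n : ℕ) (S : FlowState d s) : AgreeSector n S S :=
  ⟨fun _ => rfl, fun _ => ⟨rfl, .of_forall fun _ => rfl⟩⟩

lemma symm (h : AgreeSector n S T) : AgreeSector n T S :=
  ⟨fun hn => (h.1 hn).symm, fun b => ⟨(h.2 b).1.symm, by
    rw [← (h.2 b).1]
    exact (h.2 b).2.mono fun _ => Eq.symm⟩⟩

lemma trans (h : AgreeSector n S T) (h' : AgreeSector n T U) : AgreeSector n S U :=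
  ⟨fun hn => (h.1 hn).trans (h'.1 hn), fun b => ⟨(h.2 b).1.trans (h'.2 b).1, by
    have hTU := (h'.2 b).2
    rw [← (h.2 b).1] at hTU
    exact Filter.EventuallyEq.trans (h.2 b).2 hTU⟩⟩

lemma pair_eq (h : AgreeSector n S T) {f : Legs d s p → ℂ}
    (hf : ∀ c, c ∉ sectorSet d s n p → f c = 0) : (S.vert p).pair f = (T.vert p).pair f :=
  integral_eq_of_restrict_eq (h.2 p).1 ((h.2 p).2.mono fun c hc => by simp only [hc])
    (.of_forall fun c hc => by rw [hf c hc, zero_mul])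
    (.of_forall fun c hc => by rw [hf c hc, zero_mul])

end AgreeSector

/-- Two states have the same `j`-body sectors for all `1 ≤ j ≤ n`. -/
def AgreeUpTo (n : ℕ) (S T : FlowState d s) : Prop :=
  ∀ j, 1 ≤ j → j ≤ n → AgreeSector j S T

/-- The arguments of the `b`-body vertex function that belong to one of the `j`-body sectors,
`1 ≤ j ≤ n`. -/
def sectorsUpTo (d s n b : ℕ) : Set (Legs d s b) := ⋃ j ∈ Set.Icc 1 n, sectorSet d s j b

/-- The arguments of a ring at which all of its vertices belong to the `j`-body sectors,
`1 ≤ j ≤ n`. -/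
def ringSectorsUpTo (d s n : ℕ) (β : Fin r → ℕ) : Set (RingLegs d s β) :=
  Set.univ.pi fun v => sectorsUpTo d s n (β v + 2)

lemma Allowed.mem_sectorsUpTo {c : Legs d s p} (hc : Allowed c) (hn : peak c ≤ n) :
    c ∈ sectorsUpTo d s n p :=
  Set.mem_biUnion ⟨one_le_two.trans (allowed_iff.1 hc).2.1, hn⟩ (hc.mem_sectorSet_iff.2 rfl)

namespace AgreeUpTo

lemma refl (n : ℕ) (S : FlowState d s) : AgreeUpTo n S S := fun j _ _ => .refl j S

lemma symm (h : AgreeUpTo n S T) : AgreeUpTo n T S := fun j hj hjn => (h j hj hjn).symm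

lemma trans (h : AgreeUpTo n S T) (h' : AgreeUpTo n T U) : AgreeUpTo n S U := fun j hj hjn =>
  (h j hj hjn).trans (h' j hj hjn)

lemma mono {m : ℕ} (h : AgreeUpTo n S T) (hmn : m ≤ n) : AgreeUpTo m S T := fun j hj hjm =>
  h j hj (hjm.trans hmn)

lemma prop_eq (h : AgreeUpTo n S T) (hn : 1 ≤ n) : S.prop = T.prop := (h 1 le_rfl hn).1 rfl

lemma restrict_sectorsUpTo_eq (h : AgreeUpTo n S T) (b : ℕ) :
    (S.vert b).var.restrict (sectorsUpTo d s n b) =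
      (T.vert b).var.restrict (sectorsUpTo d s n b) :=
  (Measure.restrict_biUnion_congr (Set.to_countable _)).2 fun j hj => ((h j hj.1 hj.2).2 b).1

lemma phase_ae_eq (h : AgreeUpTo n S T) (b : ℕ) :
    (S.vert b).phase =ᵐ[(S.vert b).var.restrict (sectorsUpTo d s n b)] (T.vert b).phase :=
  (ae_restrict_biUnion_iff _ (Set.to_countable _) _).2 fun j hj => ((h j hj.1 hj.2).2 b).2

lemma restrict_ringMeasure_eq (h : AgreeUpTo n S T) (β : Fin r → ℕ) :
    (ringMeasure S β).restrict (ringSectorsUpTo d s n β) =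
      (ringMeasure T β).restrict (ringSectorsUpTo d s n β) := by
  simp only [ringMeasure, ringSectorsUpTo, Measure.restrict_pi_pi, h.restrict_sectorsUpTo_eq]

lemma ae_phase_eq (h : AgreeUpTo n S T) (β : Fin r → ℕ) :
    ∀ᵐ x ∂(ringMeasure S β).restrict (ringSectorsUpTo d s n β),
      ∀ v, (S.vert (β v + 2)).phase (x v) = (T.vert (β v + 2)).phase (x v) := by
  rw [ringMeasure, ringSectorsUpTo, Measure.restrict_pi_pi]
  exact ae_all_iff.2 fun v => (Measure.tendsto_eval_ae_ae (i := v)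
    (μ := fun v => (S.vert (β v + 2)).var.restrict (sectorsUpTo d s n (β v + 2)))).eventually
    (h.phase_ae_eq (β v + 2))

end AgreeUpTo

variable {o : Fin r → Bool} {β : Fin r → ℕ} {e' : ExtOut o β ≃ Fin p} {e : ExtIn o β ≃ Fin p}
  {f : Legs d s p → ℂ}

lemma AgreeUpTo.ringIntegrand_ae_eq (h : AgreeUpTo n S T) (hn : 1 ≤ n) :
    ringIntegrand Rd S o β e' e f =ᵐ[(ringMeasure S β).restrict (ringSectorsUpTo d s n β)]
      ringIntegrand Rd T o β e' e f := by
  filter_upwards [h.ae_phase_eq β] with x hx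
  simp only [ringIntegrand, h.prop_eq hn, hx]

lemma Admissible.ringIntegrand_eq_zero (hS : Admissible Rd S)
    (hf : ∀ c, c ∉ sectorSet d s n p → f c = 0) :
    ∀ᵐ x ∂ringMeasure S β, x ∉ ringSectorsUpTo d s n β → ringIntegrand Rd S o β e' e f x = 0 := by
  filter_upwards [hS.ae_allowed β] with x hx
  contrapose!
  intro hne v _
  have hext : extLegs o β e' e x ∈ sectorSet d s n p :=
    not_not.1 (mt (hf _) (left_ne_zero_of_mul (left_ne_zero_of_mul hne)))
  refine (hx v).mem_sectorsUpTo ?_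
  calc peak (x v)
    _ ≤ peak (extLegs o β e' e x) :=
      (hS.forwardLines hne).peak_le_peak_extLegs (fun w => (hx w).1) e' e v
    _ ≤ n := peak_le_of_mem_sectorSet hext

theorem AgreeUpTo.sameSectorFlow (h : AgreeUpTo n S T) (hn : 1 ≤ n) (hS : Admissible Rd S)
    (hT : Admissible Rd T) : SameSectorFlow Rd n S T := by
  refine ⟨fun _ x y => ⟨iff_of_true (hS.flowConverges_one _) (hT.flowConverges_one _), ?_⟩,
    fun b f hf => ⟨?_, ?_⟩⟩
  · rw [hS.propRHS_eq_propDot, hT.propRHS_eq_propDot, h.prop_eq hn]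
  · unfold FlowConverges
    congr! 6 with r _ o β e' e
    exact integrable_iff_of_restrict_eq (h.restrict_ringMeasure_eq _) (h.ringIntegrand_ae_eq hn)
      (hS.ringIntegrand_eq_zero hf.2) (hT.ringIntegrand_eq_zero hf.2)
  · unfold flowRHS
    congr! 6 with r _ o _ β _ e' _ e _
    exact integral_eq_of_restrict_eq (h.restrict_ringMeasure_eq _) (h.ringIntegrand_ae_eq hn)
      (hS.ringIntegrand_eq_zero hf.2) (hT.ringIntegrand_eq_zero hf.2)

end Dependence

/-! ### Solutions -/

section Solutions

variable {d s b n : ℕ} {K : Set ℝ} {Rd : ℝ → Vertex d s 1} {Γ Γ' : ℝ → FlowState d s}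

lemma solvesVertex_zero : SolvesVertex K Rd Γ (0 : Legs d s b → ℂ) := fun k _ =>
  ⟨flowConverges_zero, by
    simpa [Vertex.pair, flowRHS_zero] using hasDerivWithinAt_const k K (0 : ℂ)⟩

namespace SolvesVertex

variable {f g : Legs d s b → ℂ}

lemma add (hf : IsTest f) (hg : IsTest g) (hfs : SolvesVertex K Rd Γ f)
    (hgs : SolvesVertex K Rd Γ g) : SolvesVertex K Rd Γ (f + g) := fun k hk => by
  obtain ⟨hf_conv, hf_deriv⟩ := hfs k hk
  obtain ⟨hg_conv, hg_deriv⟩ := hgs k hk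
  refine ⟨hf_conv.add hg_conv, ?_⟩
  simpa only [Vertex.pair_add _ hf hg, flowRHS_add hf_conv hg_conv] using hf_deriv.fun_add hg_deriv

lemma sum {ι : Type*} {t : Finset ι} {f : ι → Legs d s b → ℂ} (hf : ∀ i ∈ t, IsTest (f i))
    (hfs : ∀ i ∈ t, SolvesVertex K Rd Γ (f i)) : SolvesVertex K Rd Γ (∑ i ∈ t, f i) :=
  (Finset.sum_induction f (fun g => IsTest g ∧ SolvesVertex K Rd Γ g)
    (fun _ _ hg hg' => ⟨hg.1.add hg'.1, add hg.1 hg'.1 hg.2 hg'.2⟩)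
    ⟨isTest_zero, solvesVertex_zero⟩ fun i hi => ⟨hf i hi, hfs i hi⟩).2

lemma congr (hfs : SolvesVertex K Rd Γ f) (hΓ : ∀ k ∈ K, Admissible (Rd k) (Γ k)) (hb : 2 ≤ b)
    (hfg : ∀ c, Allowed c → f c = g c) : SolvesVertex K Rd Γ g := fun k hk => by
  obtain ⟨hconv, hderiv⟩ := hfs k hk
  refine ⟨(hΓ k hk).flowConverges_congr hfg hconv, ?_⟩
  rw [← (hΓ k hk).flowRHS_congr hfg]
  exact hderiv.congr_of_mem (fun l hl => ((hΓ l hl).pair_congr hb hfg).symm) hk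

end SolvesVertex

lemma SolvesFlow.solvesSector (h : SolvesFlow K Rd Γ) (n : ℕ) : SolvesSector K Rd n Γ := by
  refine ⟨fun _ => h.1, fun b f hf => ?_⟩
  by_cases hb : 2 ≤ b
  · exact h.2 b hb f hf.1
  · rw [hf.eq_zero (by omega)]
    exact solvesVertex_zero

theorem solvesFlow_iff_forall_solvesSector (hΓ : ∀ k ∈ K, Admissible (Rd k) (Γ k)) :
    SolvesFlow K Rd Γ ↔ ∀ n, 1 ≤ n → SolvesSector K Rd n Γ := by
  refine ⟨fun h n _ => h.solvesSector n, fun h => ⟨(h 1 le_rfl).1 rfl, fun b hb f hf => ?_⟩⟩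
  have hparts : SolvesVertex K Rd Γ (∑ j ∈ Finset.Icc 1 b, (sectorSet d s j b).indicator f) :=
    .sum (fun j _ => (hf.isSectorTest_indicator j).1) fun j hj =>
      (h j (Finset.mem_Icc.1 hj).1).2 b _ (hf.isSectorTest_indicator j)
  exact hparts.congr hΓ hb fun c hc => hc.sum_indicator_sectorSet f

lemma solvesSector_one_of_hasDerivWithinAt_propDot (hΓ : ∀ k ∈ K, Admissible (Rd k) (Γ k))
    (h : ∀ k ∈ K, ∀ x y,
      HasDerivWithinAt (fun l => (Γ l).prop x y) (propDot (Rd k) (Γ k).prop x y) K k) :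
    SolvesSector K Rd 1 Γ := by
  refine ⟨fun _ k hk x y => ⟨(hΓ k hk).flowConverges_one _, ?_⟩, fun b f hf => ?_⟩
  · rw [(hΓ k hk).propRHS_eq_propDot]
    exact h k hk x y
  · rw [hf.eq_zero (by omega)]
    exact solvesVertex_zero

theorem SolvesSector.of_agreeUpTo (hs : SolvesSector K Rd n Γ) (hn : 1 ≤ n)
    (hΓ : ∀ k ∈ K, Admissible (Rd k) (Γ k)) (hΓ' : ∀ k ∈ K, Admissible (Rd k) (Γ' k))
    (h : ∀ k ∈ K, AgreeUpTo n (Γ k) (Γ' k)) : SolvesSector K Rd n Γ' := by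
  have hsame := fun k hk => (h k hk).sameSectorFlow hn (hΓ k hk) (hΓ' k hk)
  refine ⟨fun h1 k hk x y => ?_, fun b f hf k hk => ?_⟩
  · obtain ⟨hconv, hderiv⟩ := hs.1 h1 k hk x y
    obtain ⟨hiff, heq⟩ := (hsame k hk).1 h1 x y
    refine ⟨hiff.1 hconv, ?_⟩
    rw [← heq]
    exact hderiv.congr_of_mem (fun l hl => by rw [(h l hl).prop_eq hn]) hk
  · obtain ⟨hconv, hderiv⟩ := hs.2 b f hf k hk
    obtain ⟨hiff, heq⟩ := (hsame k hk).2 b f hf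
    refine ⟨hiff.1 hconv, ?_⟩
    rw [← heq]
    exact hderiv.congr_of_mem (fun l hl => ((h l hl n hn le_rfl).pair_eq hf.2).symm) hk

end Solutions

section Diagonal

variable {d s : ℕ} {Γ : ℕ → FlowState d s}

/-- The state whose `b`-body vertex function is taken from the `b`-th of a sequence of states. The
sequence starts at the index `2`, whence the maximum. -/
def diagonalState (Γ : ℕ → FlowState d s) : FlowState d s where
  prop := (Γ 2).prop
  measurable_prop := (Γ 2).measurable_prop
  vert b := (Γ (max b 2)).vert b

lemma admissible_diagonalState {Rd : Vertex d s 1} (h : ∀ n, 2 ≤ n → Admissible Rd (Γ n)) :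
    Admissible Rd (diagonalState Γ) where
  retarded := (h 2 le_rfl).retarded
  integrable_dot := (h 2 le_rfl).integrable_dot
  retarded_dot := (h 2 le_rfl).retarded_dot
  allowed b hb := (h (max b 2) (le_max_right _ _)).allowed b hb

lemma agreeUpTo_of_le (h : ∀ n, 2 ≤ n → AgreeUpTo n (Γ n) (Γ (n + 1))) {n m : ℕ} (hn : 2 ≤ n)
    (hnm : n ≤ m) : AgreeUpTo n (Γ n) (Γ m) := by
  induction m, hnm using Nat.le_induction with
  | base => exact .refl n _
  | succ m hm ih => exact ih.trans ((h m (hn.trans hm)).mono hm)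

lemma agreeUpTo_diagonalState (h : ∀ n, 2 ≤ n → AgreeUpTo n (Γ n) (Γ (n + 1))) {n : ℕ}
    (hn : 2 ≤ n) : AgreeUpTo n (Γ n) (diagonalState Γ) := by
  refine fun j hj hjn => ⟨fun _ => ?_, fun b => ?_⟩
  · exact ((agreeUpTo_of_le h le_rfl hn).prop_eq one_le_two).symm
  · rcases lt_or_ge b j with hbj | hjb
    · simp [sectorSet_eq_empty (Or.inr hbj)]
    · rcases le_total n (max b 2) with hle | hle
      · exact (agreeUpTo_of_le h hn hle j hj hjn).2 b
      · exact (agreeUpTo_of_le h (le_max_right _ _) hle j hj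
          (hjb.trans (le_max_left _ _))).symm.2 b

theorem solvesFlow_diagonalState {K : Set ℝ} {Rd : ℝ → Vertex d s 1} {Γ : ℕ → ℝ → FlowState d s}
    (hΓ : ∀ n, 2 ≤ n → ∀ k ∈ K, Admissible (Rd k) (Γ n k))
    (hprop : ∀ k ∈ K, ∀ x y, HasDerivWithinAt (fun l => (Γ 2 l).prop x y)
      (propDot (Rd k) (Γ 2 k).prop x y) K k)
    (hsol : ∀ n, 2 ≤ n → SolvesSector K Rd n (Γ n))
    (hagree : ∀ k ∈ K, ∀ n, 2 ≤ n → AgreeUpTo n (Γ n k) (Γ (n + 1) k)) :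
    SolvesFlow K Rd fun k => diagonalState fun n => Γ n k := by
  have hadm : ∀ k ∈ K, Admissible (Rd k) (diagonalState fun n => Γ n k) := fun k hk =>
    admissible_diagonalState fun n hn => hΓ n hn k hk
  refine (solvesFlow_iff_forall_solvesSector hadm).2 fun n hn => ?_
  rcases hn.eq_or_lt with rfl | hn2
  · exact solvesSector_one_of_hasDerivWithinAt_propDot hadm hprop
  · exact (hsol n hn2).of_agreeUpTo hn (hΓ n hn2) hadm fun k hk =>
      agreeUpTo_diagonalState (hagree k hk) hn2

end Diagonal

theorem mainTheorem2 (d s : ℕ) :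
    -- the flow equations for the `n`-body sector depend only on the sectors `j ≤ n`
    (∀ (Rd : Vertex d s 1) (S T : FlowState d s), Admissible Rd S → Admissible Rd T →
      ∀ n, 1 ≤ n → (∀ j, 1 ≤ j → j ≤ n → AgreeSector j S T) → SameSectorFlow Rd n S T) ∧
    -- the flow generates vertex functions at allowed arguments only
    (∀ (Rd : Vertex d s 1) (S : FlowState d s), Admissible Rd S →
      ∀ (b : ℕ) (f : Legs d s b → ℂ), (∀ c, Allowed c → f c = 0) → flowRHS Rd S b f = 0) ∧
    -- the flow equations are the collection of the flow equations for the sectors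
    (∀ (K : Set ℝ) (Rd : ℝ → Vertex d s 1) (Γ : ℝ → FlowState d s),
      (∀ k ∈ K, Admissible (Rd k) (Γ k)) →
      (SolvesFlow K Rd Γ ↔ ∀ n, 1 ≤ n → SolvesSector K Rd n Γ)) ∧
    -- to solve those for the `n`-body sector only the sectors `j ≤ n` have to be known
    (∀ (K : Set ℝ) (Rd : ℝ → Vertex d s 1) (Γ Γ' : ℝ → FlowState d s),
      (∀ k ∈ K, Admissible (Rd k) (Γ k)) → (∀ k ∈ K, Admissible (Rd k) (Γ' k)) →
      ∀ n, 1 ≤ n → (∀ k ∈ K, ∀ j, 1 ≤ j → j ≤ n → AgreeSector j (Γ k) (Γ' k)) →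
        (SolvesSector K Rd n Γ ↔ SolvesSector K Rd n Γ')) ∧
    -- solutions for the sectors `n = 2, 3, …`, found successively, make up a full solution
    (∀ (K : Set ℝ) (Rd : ℝ → Vertex d s 1) (Γ : ℕ → ℝ → FlowState d s),
      (∀ n, 2 ≤ n → ∀ k ∈ K, Admissible (Rd k) (Γ n k)) →
      (∀ k ∈ K, ∀ x y, HasDerivWithinAt (fun l => (Γ 2 l).prop x y)
        (propDot (Rd k) (Γ 2 k).prop x y) K k) →
      (∀ n, 2 ≤ n → SolvesSector K Rd n (Γ n)) →
      (∀ n, 2 ≤ n → ∀ k ∈ K, ∀ j, 1 ≤ j → j ≤ n → AgreeSector j (Γ n k) (Γ (n + 1) k)) →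
      ∃ Γ' : ℝ → FlowState d s, (∀ k ∈ K, Admissible (Rd k) (Γ' k)) ∧
        (∀ n, 2 ≤ n → ∀ k ∈ K, ∀ j, 1 ≤ j → j ≤ n → AgreeSector j (Γ n k) (Γ' k)) ∧
        SolvesFlow K Rd Γ') := by
  refine ⟨fun Rd S T hS hT n hn h => AgreeUpTo.sameSectorFlow h hn hS hT,
    fun Rd S hS b f hf => hS.flowRHS_eq_zero hf,
    fun K Rd Γ hΓ => solvesFlow_iff_forall_solvesSector hΓ,
    fun K Rd Γ Γ' hΓ hΓ' n hn h => ⟨fun hs => hs.of_agreeUpTo hn hΓ hΓ' h,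
      fun hs => hs.of_agreeUpTo hn hΓ' hΓ fun k hk => AgreeUpTo.symm (h k hk)⟩,
    fun K Rd Γ hΓ hprop hsol hagree => ⟨fun k => diagonalState fun n => Γ n k, ?_, ?_, ?_⟩⟩
  · exact fun k hk => admissible_diagonalState fun n hn => hΓ n hn k hk
  · exact fun n hn k hk => agreeUpTo_diagonalState (fun m hm => hagree m hm k hk) hn
  · exact solvesFlow_diagonalState hΓ hprop hsol fun k hk n hn => hagree n hn k hk
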